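/- Let $n>2$ be an integer and let $\nu$ be a real number with $\nu>\frac{n-2}{2}$. For $z\in\mathbb{C}^n$ write $zz^t=z_1^2+\cdots+z_n^2$, and let $$\mathscr{D}=\{z\in\mathbb{C}^n : 1-2\langle z,z\rangle+|zz^t|^2>0,\ |z|<1\}$$ be the Lie ball, where $\langle z,w\rangle=\sum_i z_i\overline{w_i}$ and $|z|^2=\langle z,z\rangle$. Put $h(z,w)=1-2\langle z,w\rangle+(zz^t)\overline{(ww^t)}$ and $K_\nu(z,w)=h(z,w)^{-\nu}$ for $z,w\in\mathscr{D}$ (principal power; $h(z,w)\notin(-\infty,0]$ there). Then $K_\nu$ is a positive semidefinite kernel on $\mathscr{D}$. Let $\mathscr{H}_\nu$ be the Hilbert space of functions on $\mathscr{D}$ with reproducing kernel $K_\nu$, and $\|\cdot\|_\nu$ its norm. For every integer $k\ge 0$ the function $z\mapsto (zz^t)^k$ belongs to $\mathscr{H}_\nu$, and $$\|(zz^t)^k\|_\nu^2=\frac{k!\,\left(\frac n2\right)_k}{(\nu)_k\left(\nu-\frac{n-2}{2}\right)_k},$$ where $(a)_k=a(a+1)\cdots(a+k-1)$ and $(a)_0=1$.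 -/

import Mathlib

/-- The quadratic form `q(z) = z zᵗ = z₁² + ⋯ + zₙ²` on `ℂⁿ` (bilinear, without conjugation). -/
def quadForm {n : ℕ} (z : EuclideanSpace ℂ (Fin n)) : ℂ :=
  ∑ i, z i ^ 2

/-- The Lie ball `{z ∈ ℂⁿ | 1 - 2⟨z, z⟩ + |z zᵗ|² > 0, |z| < 1}`, with the Euclidean norm `|z|`. -/
def lieBall (n : ℕ) : Set (EuclideanSpace ℂ (Fin n)) :=
  {z | 0 < 1 - 2 * ‖z‖ ^ 2 + ‖quadForm z‖ ^ 2 ∧ ‖z‖ < 1}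

/-- `h(z, w) = 1 - 2⟨z, w⟩ + (z zᵗ) conj(w wᵗ)`, where `⟨z, w⟩ = ∑ zᵢ conj(wᵢ)` is linear in `z`. -/
noncomputable def lieH {n : ℕ} (z w : EuclideanSpace ℂ (Fin n)) : ℂ :=
  1 - 2 * ∑ i, z i * (starRingEnd ℂ) (w i) + quadForm z * (starRingEnd ℂ) (quadForm w)

/-- The kernel `K_ν(z, w) = h(z, w)^(-ν)` on the Lie ball. The values of a kernel in Mathlib's
sense are operators on `ℂ`; here they are the multiplications by the numbers `h(z, w)^(-ν)`.
The power is the principal one: for `z, w` in the Lie ball, `h(z, w)` never lies on `(-∞, 0]`, so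
this is the branch that is holomorphic in `z`, antiholomorphic in `w`, and equal to `1` at
`z = w = 0`. -/
noncomputable def lieKernel (n : ℕ) (ν : ℝ) :
    Matrix (lieBall n) (lieBall n) (ℂ →L[ℂ] ℂ) :=
  Matrix.of fun z w =>
    (lieH (z : EuclideanSpace ℂ (Fin n)) (w : EuclideanSpace ℂ (Fin n)) ^ (-(ν : ℂ))) •
      ContinuousLinearMap.id ℂ ℂ

/-- The Hilbert space `H_ν` of functions on the Lie ball with reproducing kernel `K_ν`: the
completion of the span of the functions `K_ν(·, w)` for the inner product with
`⟨K_ν(·, w), K_ν(·, w')⟩ = K_ν(w', w)` (for the inner product linear in the first variable).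
It exists as soon as `K_ν` is positive semidefinite. -/
abbrev LieHilbert (n : ℕ) (ν : ℝ) [Fact (lieKernel n ν).PosSemidef] : Type :=
  RKHS.OfKernel (lieKernel n ν)

/-- The Pochhammer symbol `(a)ₖ = a (a + 1) ⋯ (a + k - 1)`. -/
noncomputable def poch (a : ℝ) (k : ℕ) : ℝ :=
  ∏ j ∈ Finset.range k, (a + j)

/-!
With `s = ⟨z, w⟩` and `p = q(z) conj(q(w))`, the kernel is `(1 - 2s + p)^(-ν)`. It expands into
zonal polynomials `Z_N^ν(z, w)`, homogeneous of degree `N` in `z`, the homogenized Gegenbauer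
polynomials. The series converges on the Lie ball because there both roots of `X² - 2sX + p` lie in
the open unit disc.

For `μ = (n - 2)/2` the polynomial `Z_N^μ(·, w)` is harmonic and is, up to a positive constant, the
reproducing kernel of the harmonic polynomials of degree `N` for the Fischer inner product. Since
`Δ Z_N^ν = 4ν(ν - μ) conj(q(w)) Z_{N-2}^{ν+1}`, induction on `N` writes `Z_N^ν` for `ν > μ` as a
combination of `q(z)^j conj(q(w))^j Z_{N-2j}^μ` with nonnegative coefficients, so it is positive
semidefinite.

The Fourier coefficients of `t ↦ K_ν(·, e^(-it)w)` in the Hilbert space put `Z_N^ν(·, w)` in it and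
show that it reproduces the value at `w` of every homogeneous polynomial of degree `N` in the space.
Finally `F ↦ Δᵏ F` on degree `2k` is a combination of evaluations at points of the Lie ball, and
`Δᵏ Z_{2k}^ν(·, w) = 4ᵏ (ν)ₖ (ν - μ)ₖ conj(q(w))ᵏ`. The same combination of the functions
`Z_{2k}^ν(·, w)`, suitably conjugated, is therefore a multiple of `qᵏ`, and the squared norm of `qᵏ`
is `Δᵏ qᵏ = 4ᵏ k! (n/2)ₖ` divided by `4ᵏ (ν)ₖ (ν - μ)ₖ`.
-/

section BinomialPowerSeries

open PowerSeries

variable {K R S : Type*} [Field K] [CommRing R] [Algebra K R] [CommRing S] [Algebra K S]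

theorem derivation_two (D : Derivation K R R) : D 2 = 0 := by
  simpa using D.map_natCast 2

theorem derivation_subst (D : Derivation K R⟦X⟧ R⟦X⟧) {u : R⟦X⟧} (hu : constantCoeff u = 0)
    (f : K⟦X⟧) : D (f.subst u) = (d⁄dX K f).subst u * D u := by
  have hsubst : HasSubst u := .of_constantCoeff_zero' hu
  have hpoly (g : Polynomial K) :
      D ((g : K⟦X⟧).subst u) = (d⁄dX K (g : K⟦X⟧)).subst u * D u := by
    rw [subst_coe hsubst, derivative_coe, subst_coe hsubst, Derivation.map_aeval, smul_eq_mul]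
  have hshift (m : ℕ) (g : K⟦X⟧) :
      D ((X ^ (m + 1) * g).subst u) - (d⁄dX K (X ^ (m + 1) * g)).subst u * D u =
        u ^ m * (u * D (g.subst u) - u * (d⁄dX K g).subst u * D u) := by
    have hX := hpoly (Polynomial.X ^ (m + 1))
    simp only [Polynomial.coe_pow, Polynomial.coe_X] at hX
    simp only [subst_mul hsubst, subst_add hsubst, Derivation.leibniz, smul_eq_mul, hX]
    rw [subst_pow hsubst, subst_X hsubst]
    ring
  ext N
  have hdvd : X ^ (N + 1) ∣ D (f.subst u) - (d⁄dX K f).subst u * D u := by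
    rw [eq_X_pow_mul_shift_add_trunc (N + 2) f, map_add, subst_add hsubst, subst_add hsubst,
      map_add, hpoly, add_mul, add_sub_add_right_eq_sub, hshift]
    exact (pow_dvd_pow_of_dvd (X_dvd_iff.2 hu) _).mul_right _
  rw [← sub_eq_zero, ← map_sub]
  exact X_pow_dvd_iff.1 hdvd N N.lt_succ_self

/-- The derivation of `R⟦X⟧` that applies a derivation of `R` to each coefficient. -/
noncomputable def coeffDerivation (D : Derivation K R R) : Derivation K R⟦X⟧ R⟦X⟧ :=
  Derivation.mk'
    { toFun := fun f => mk fun N => D (coeff N f)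
      map_add' := fun f g => by ext; simp
      map_smul' := fun c f => by ext; simp }
    fun f g => by
      ext N
      simp only [LinearMap.coe_mk, AddHom.coe_mk, coeff_mk, coeff_mul, map_sum,
        Derivation.leibniz, smul_eq_mul, map_add, Finset.sum_add_distrib]
      congr 1
      exact Finset.Nat.sum_antidiagonal_swap (f := fun x => coeff x.1 g * D (coeff x.2 f))

@[simp]
theorem coeff_coeffDerivation (D : Derivation K R R) (f : R⟦X⟧) (N : ℕ) :
    coeff N (coeffDerivation D f) = D (coeff N f) :=
  coeff_mk N fun N => D (coeff N f)

theorem coeffDerivation_C (D : Derivation K R R) (a : R) :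
    coeffDerivation D (C a) = C (D a) := by
  ext N
  simp only [coeff_coeffDerivation, coeff_C]
  split_ifs <;> simp

theorem coeffDerivation_X (D : Derivation K R R) : coeffDerivation D (X : R⟦X⟧) = 0 := by
  ext N
  simp only [coeff_coeffDerivation, coeff_X]
  split_ifs <;> simp

variable [CharZero K]

theorem derivative_binomialSeries (r : K) :
    d⁄dX K (binomialSeries K r) = r • binomialSeries K (r - 1) := by
  ext N
  have h := Ring.choose_smul_choose r (Nat.le_add_left 1 N)
  simp only [coeff_derivative, binomialSeries_coeff, map_smul, smul_eq_mul, mul_one]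
  simp only [Nat.choose_one_right, nsmul_eq_mul, Nat.cast_add, Nat.cast_one, Ring.choose_one_right,
    add_tsub_cancel_right] at h
  linear_combination h

/-- The power series `(1 + u)ʳ`, meaningful when `u` has no constant term. -/
noncomputable def powOneAdd (r : K) (u : R⟦X⟧) : R⟦X⟧ :=
  (binomialSeries K r).subst u

variable {u : R⟦X⟧} (hu : constantCoeff u = 0)
include hu

theorem powOneAdd_add (r r' : K) :
    powOneAdd (r + r') u = powOneAdd r u * powOneAdd r' u := by
  rw [powOneAdd, binomialSeries_add, subst_mul (.of_constantCoeff_zero' hu), powOneAdd, powOneAdd]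

theorem powOneAdd_natCast (m : ℕ) : powOneAdd (m : K) u = (1 + u) ^ m := by
  have hsubst : HasSubst u := .of_constantCoeff_zero' hu
  rw [powOneAdd, binomialSeries_nat, ← coe_substAlgHom hsubst]
  simp [substAlgHom_X]

theorem derivation_powOneAdd (D : Derivation K R⟦X⟧ R⟦X⟧) (r : K) :
    D (powOneAdd r u) = r • (powOneAdd (r - 1) u * D u) := by
  rw [powOneAdd, derivation_subst D hu, derivative_binomialSeries,
    subst_smul (.of_constantCoeff_zero' hu), smul_mul_assoc, powOneAdd]

theorem derivation_derivation_powOneAdd (D : Derivation K R⟦X⟧ R⟦X⟧) (r : K) :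
    D (D (powOneAdd r u)) = (r * (r - 1)) • (powOneAdd (r - 1 - 1) u * D u ^ 2) +
      r • (powOneAdd (r - 1) u * D (D u)) := by
  rw [derivation_powOneAdd hu, Derivation.map_smul, Derivation.leibniz, derivation_powOneAdd hu]
  simp only [smul_eq_mul, Algebra.smul_def, map_mul]
  ring

theorem powOneAdd_eq_mul_one_add (r : K) : powOneAdd r u = powOneAdd (r - 1) u * (1 + u) := by
  rw [← pow_one (1 + u), ← powOneAdd_natCast (K := K) hu, ← powOneAdd_add hu, Nat.cast_one,
    sub_add_cancel]

theorem one_add_mul_derivation_powOneAdd (D : Derivation K R⟦X⟧ R⟦X⟧) (r : K) :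
    (1 + u) * D (powOneAdd r u) = r • (powOneAdd r u * D u) := by
  rw [derivation_powOneAdd hu, powOneAdd_eq_mul_one_add hu r, mul_smul_comm]
  congr 1
  ring

theorem constantCoeff_powOneAdd (r : K) : constantCoeff (powOneAdd r u) = 1 := by
  rw [← coeff_zero_eq_constantCoeff_apply, powOneAdd, coeff_subst' (.of_constantCoeff_zero' hu),
    finsum_eq_single _ 0 fun m hm => by simp [hu, hm]]
  simp

theorem map_powOneAdd (φ : R →ₐ[K] S) (r : K) :
    PowerSeries.map (φ : R →+* S) (powOneAdd r u) =
      powOneAdd r (PowerSeries.map (φ : R →+* S) u) := by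
  have hφ : constantCoeff (PowerSeries.map (φ : R →+* S) u) = 0 := by
    rw [← coeff_zero_eq_constantCoeff_apply, coeff_map, coeff_zero_eq_constantCoeff_apply, hu,
      map_zero]
  ext N
  rw [powOneAdd, powOneAdd, coeff_map, coeff_subst' (.of_constantCoeff_zero' hu),
    coeff_subst' (.of_constantCoeff_zero' hφ)]
  refine ((φ : R →+ S).map_finsum
    (coeff_subst_finite' (.of_constantCoeff_zero' hu) _ _)).trans (finsum_congr fun m => ?_)
  simp [← map_pow]

theorem powOneAdd_mul {v : R⟦X⟧} (hv : constantCoeff v = 0) (r : K) :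
    powOneAdd r (u + v + u * v) = powOneAdd r u * powOneAdd r v := by
  let D : Derivation K R⟦X⟧ R⟦X⟧ := (d⁄dX R).restrictScalars K
  have huv : constantCoeff (u + v + u * v) = 0 := by simp [hu, hv]
  have cancel {w : R⟦X⟧} (hw : constantCoeff w = 0) (r : K) :
      powOneAdd r w * powOneAdd (-r) w = 1 := by
    rw [← powOneAdd_add hw, add_neg_cancel]
    simpa using powOneAdd_natCast (K := K) hw 0
  suffices h : powOneAdd r (u + v + u * v) * (powOneAdd (-r) u * powOneAdd (-r) v) = 1 by
    linear_combination powOneAdd r u * powOneAdd r v * h - powOneAdd r (u + v + u * v) *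
      (cancel hu r * powOneAdd r v * powOneAdd (-r) v + cancel hv r)
  have hD : (1 + u) * (1 + v) *
      D (powOneAdd r (u + v + u * v) * (powOneAdd (-r) u * powOneAdd (-r) v)) = 0 := by
    have h₀ := one_add_mul_derivation_powOneAdd huv D r
    have h₁ := one_add_mul_derivation_powOneAdd hu D (-r)
    have h₂ := one_add_mul_derivation_powOneAdd hv D (-r)
    simp only [Derivation.leibniz, map_add, smul_eq_mul, Algebra.smul_def, map_neg] at h₀ h₁ h₂ ⊢
    linear_combination powOneAdd (-r) u * powOneAdd (-r) v * h₀ +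
      powOneAdd r (u + v + u * v) * powOneAdd (-r) u * (1 + u) * h₂ +
      powOneAdd r (u + v + u * v) * powOneAdd (-r) v * (1 + v) * h₁
  have hunit : IsUnit ((1 + u) * (1 + v)) := by
    simp [isUnit_iff_constantCoeff, hu, hv]
  have : IsAddTorsionFree R := .of_isTorsionFree K R
  refine derivative.ext (R := R) ?_ ?_
  · rw [Derivation.map_one_eq_zero]
    exact hunit.mul_right_eq_zero.1 hD
  · simp [constantCoeff_powOneAdd, huv, hu, hv]

end BinomialPowerSeries

section Gegenbauer

open PowerSeries

variable {K R S : Type*} [Field K] [CommRing R] [Algebra K R] [CommRing S] [Algebra K S]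

theorem constantCoeff_gegenbauerBase (s p : R) :
    constantCoeff (C p * X ^ 2 - 2 * C s * X) = 0 := by
  simp

theorem C_smul (c : K) (a : R) : (C (c • a) : R⟦X⟧) = c • C a := by
  ext (_ | M) <;> simp [coeff_C]

theorem coeffDerivation_gegenbauerBase (D : Derivation K R R) (s p : R) :
    coeffDerivation D (C p * X ^ 2 - 2 * C s * X) = C (D p) * X ^ 2 - 2 * C (D s) * X := by
  simp only [map_sub, Derivation.leibniz, Derivation.leibniz_pow, coeffDerivation_X,
    coeffDerivation_C, derivation_two, smul_eq_mul]
  ring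

variable [CharZero K]

/-- The generating function `(1 - 2sX + pX²)^(-ν)`. -/
noncomputable def gegenbauerSeries (ν : K) (s p : R) : R⟦X⟧ :=
  powOneAdd (-ν) (C p * X ^ 2 - 2 * C s * X)

/-- The Gegenbauer polynomial `∑ (ν)ₐ₊ᵦ / (a! b!) (2s)ᵃ (-p)ᵇ` (sum over `a + 2b = N`), which is
the classical `C_N^ν(s)` at `p = 1`. -/
noncomputable def gegenbauer (ν : K) (s p : R) (N : ℕ) : R :=
  coeff N (gegenbauerSeries ν s p)

@[simp]
theorem gegenbauer_zero (ν : K) (s p : R) : gegenbauer ν s p 0 = 1 := by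
  rw [gegenbauer, coeff_zero_eq_constantCoeff_apply, gegenbauerSeries,
    constantCoeff_powOneAdd (constantCoeff_gegenbauerBase s p)]

theorem map_gegenbauer (φ : R →ₐ[K] S) (ν : K) (s p : R) (N : ℕ) :
    φ (gegenbauer ν s p N) = gegenbauer ν (φ s) (φ p) N := by
  have h := map_powOneAdd (constantCoeff_gegenbauerBase s p) φ (-ν)
  simp only [map_sub, map_mul, map_pow, map_C, map_X, RingHom.coe_coe, map_ofNat] at h
  rw [gegenbauer, gegenbauer, gegenbauerSeries, gegenbauerSeries, ← h, coeff_map, RingHom.coe_coe]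

theorem gegenbauerSeries_eq_powOneAdd_mul_powOneAdd (ν : K) {α β s p : R} (hs : α + β = 2 * s)
    (hp : α * β = p) :
    gegenbauerSeries ν s p = powOneAdd (-ν) (-(C α * X)) * powOneAdd (-ν) (-(C β * X)) := by
  have hC : C α + C β = 2 * C s := by rw [← map_add, hs, map_mul, map_ofNat]
  rw [← powOneAdd_mul (by simp) (by simp), gegenbauerSeries, ← hp, ← hC, map_mul]
  congr 1
  ring

theorem coeff_powOneAdd_C_mul_X (r : K) (a : R) (N : ℕ) :
    coeff N (powOneAdd r (C a * X)) = Ring.choose r N • a ^ N := by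
  rw [powOneAdd, coeff_subst' (.of_constantCoeff_zero' (by simp)), finsum_eq_single _ N]
  · simp [mul_pow, ← map_pow]
  · intro m hm
    simp [mul_pow, ← map_pow, hm.symm]

theorem gegenbauer_zero_right (ν : K) (s : R) (N : ℕ) :
    gegenbauer ν s 0 N = Ring.multichoose ν N • (2 * s) ^ N := by
  have h : C (0 : R) * X ^ 2 - 2 * C s * X = C (-(2 * s)) * X := by
    simp only [map_zero, zero_mul, zero_sub, map_neg, map_mul, map_ofNat, neg_mul]
  rw [gegenbauer, gegenbauerSeries, h, coeff_powOneAdd_C_mul_X, Ring.choose_neg', neg_pow (2 * s)]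
  rcases N.even_or_odd with hN | hN <;> simp [hN, Int.negOnePow_even, Int.negOnePow_odd]

theorem dvd_gegenbauer_sub_smul_pow (ν : K) (s p : R) (N : ℕ) :
    p ∣ gegenbauer ν s p N - Ring.multichoose ν N • (2 * s) ^ N := by
  rw [← Ideal.mem_span_singleton, ← Ideal.Quotient.eq]
  have h := map_gegenbauer (Ideal.Quotient.mkₐ K (Ideal.span {p})) ν s p N
  have hp : Ideal.Quotient.mkₐ K (Ideal.span {p}) p = 0 :=
    Ideal.Quotient.eq_zero_iff_mem.2 (Ideal.mem_span_singleton_self p)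
  rw [hp, gegenbauer_zero_right, ← map_ofNat (Ideal.Quotient.mkₐ K (Ideal.span {p})), ← map_mul,
    ← map_pow, ← map_smul] at h
  exact h

/-- Bernstein's identity for `h = 1 - 2sX + pX²`: the hypotheses say that `∑ (Dᵢ h)² = 4AX² h`
and `∑ Dᵢ² h = 4dAX²`. -/
theorem sum_coeffDerivation_coeffDerivation_gegenbauerSeries {ι : Type*} [Fintype ι]
    (D : ι → Derivation K R R) {s p A : R} {d : K} (hss : ∑ i, D i s ^ 2 = A)
    (hsp : ∑ i, D i s * D i p = 2 * A * s) (hpp : ∑ i, D i p ^ 2 = 4 * A * p)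
    (hs : ∑ i, D i (D i s) = 0) (hp : ∑ i, D i (D i p) = (4 * d) • A) (ν : K) :
    ∑ i, coeffDerivation (D i) (coeffDerivation (D i) (gegenbauerSeries ν s p)) =
      C ((4 * ν * (ν + 1 - d)) • A) * gegenbauerSeries (ν + 1) s p * X ^ 2 := by
  have hu := constantCoeff_gegenbauerBase s p
  simp only [gegenbauerSeries]
  set u : R⟦X⟧ := C p * X ^ 2 - 2 * C s * X with hudef
  have hDu : ∑ i, coeffDerivation (D i) u ^ 2 = 4 * C A * X ^ 2 * (1 + u) := by
    have hC : ∑ i, coeffDerivation (D i) u ^ 2 = X ^ 4 * C (∑ i, D i p ^ 2) -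
        4 * X ^ 3 * C (∑ i, D i s * D i p) + 4 * X ^ 2 * C (∑ i, D i s ^ 2) := by
      simp only [hudef, coeffDerivation_gegenbauerBase, map_sum, map_pow, map_mul,
        Finset.mul_sum, ← Finset.sum_add_distrib, ← Finset.sum_sub_distrib]
      exact Finset.sum_congr rfl fun i _ => by ring
    rw [hC, hss, hsp, hpp, hudef]
    simp only [map_mul, map_ofNat]
    ring
  have hDDu : ∑ i, coeffDerivation (D i) (coeffDerivation (D i) u) =
      (4 * d) • (C A * X ^ 2) := by
    simp only [hudef, coeffDerivation_gegenbauerBase, Finset.sum_sub_distrib, ← Finset.mul_sum,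
      ← Finset.sum_mul, ← map_sum, hs, hp, map_zero, mul_zero, zero_mul, sub_zero]
    rw [C_smul, smul_mul_assoc]
  simp only [derivation_derivation_powOneAdd hu, Finset.sum_add_distrib, ← Finset.smul_sum,
    ← Finset.mul_sum, hDu, hDDu]
  rw [C_smul, neg_add', powOneAdd_eq_mul_one_add hu (-ν - 1)]
  simp only [Algebra.smul_def, map_mul, map_neg, map_sub, map_add, map_ofNat, map_one]
  ring

end Gegenbauer

section Zonal

open MvPolynomial

theorem isHomogeneous_coeff_pow {σ R : Type*} [CommSemiring R]
    {u : PowerSeries (MvPolynomial σ R)} (hu : ∀ N, (PowerSeries.coeff N u).IsHomogeneous N)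
    (d N : ℕ) : (PowerSeries.coeff N (u ^ d)).IsHomogeneous N := by
  induction d generalizing N with
  | zero =>
    rw [pow_zero, PowerSeries.coeff_one]
    split_ifs with hN
    · exact hN ▸ isHomogeneous_one σ R
    · exact isHomogeneous_zero σ R N
  | succ d ih =>
    rw [pow_succ, PowerSeries.coeff_mul]
    exact .sum _ _ _ fun x hx =>
      Finset.HasAntidiagonal.mem_antidiagonal.1 hx ▸ (ih x.1).mul (hu x.2)

variable {σ K : Type*} [Fintype σ] [Field K]

/-- The quadratic form `∑ Xᵢ²` as a polynomial. -/
noncomputable def quadPoly (σ K : Type*) [Fintype σ] [CommSemiring K] : MvPolynomial σ K :=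
  ∑ i, X i ^ 2

/-- The linear form `∑ vᵢXᵢ` as a polynomial. -/
noncomputable def linPoly (v : σ → K) : MvPolynomial σ K :=
  ∑ i, C (v i) * X i

/-- The Laplacian `∑ ∂ᵢ²` on polynomials. -/
noncomputable def laplacian : MvPolynomial σ K →ₗ[K] MvPolynomial σ K :=
  ∑ i, (pderiv i).toLinearMap ∘ₗ (pderiv i).toLinearMap

theorem laplacian_apply (f : MvPolynomial σ K) : laplacian f = ∑ i, pderiv i (pderiv i f) := by
  simp [laplacian]

theorem isHomogeneous_quadPoly : (quadPoly σ K).IsHomogeneous 2 :=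
  .sum _ _ _ fun i _ => isHomogeneous_X_pow i 2

theorem isHomogeneous_linPoly (v : σ → K) : (linPoly v).IsHomogeneous 1 :=
  .sum _ _ _ fun i _ => isHomogeneous_C_mul_X (v i) i

theorem eval_quadPoly (z : σ → K) : eval z (quadPoly σ K) = ∑ i, z i ^ 2 := by
  simp [quadPoly]

theorem eval_linPoly (v z : σ → K) : eval z (linPoly v) = ∑ i, v i * z i := by
  simp [linPoly]

theorem pderiv_quadPoly (i : σ) : pderiv i (quadPoly σ K) = 2 * X i := by
  classical
  simp [quadPoly, pderiv_X, Pi.single_apply]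

theorem pderiv_linPoly (v : σ → K) (i : σ) : pderiv i (linPoly v) = C (v i) := by
  classical
  simp [linPoly, pderiv_X, Pi.single_apply]

theorem laplacian_quadPoly_mul {f : MvPolynomial σ K} {l : ℕ} (hf : f.IsHomogeneous l) :
    laplacian (quadPoly σ K * f) =
      quadPoly σ K * laplacian f + (2 * Fintype.card σ + 4 * l : K) • f := by
  have hterm (i : σ) : pderiv i (pderiv i (quadPoly σ K * f)) =
      quadPoly σ K * pderiv i (pderiv i f) + 2 * f + 4 * (X i * pderiv i f) := by
    simp only [pderiv_mul, map_add, pderiv_quadPoly, pderiv_X_self, derivation_two]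
    ring
  rw [laplacian_apply, laplacian_apply, Finset.sum_congr rfl fun i _ => hterm i,
    Finset.sum_add_distrib, Finset.sum_add_distrib, ← Finset.mul_sum, ← Finset.mul_sum,
    ← Finset.mul_sum, hf.sum_X_mul_pderiv]
  rw [Finset.sum_const, Finset.card_univ, nsmul_eq_mul, nsmul_eq_mul, Algebra.smul_def]
  simp only [map_add, map_mul, map_ofNat, map_natCast]
  ring

theorem laplacian_quadPoly_pow_mul {h : MvPolynomial σ K} {l : ℕ} (hl : h.IsHomogeneous l)
    (hh : laplacian h = 0) (j : ℕ) :
    laplacian (quadPoly σ K ^ (j + 1) * h) =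
      (2 * (j + 1) * (2 * j + Fintype.card σ + 2 * l) : K) • (quadPoly σ K ^ j * h) := by
  induction j with
  | zero =>
    rw [zero_add, pow_one, laplacian_quadPoly_mul hl, hh, mul_zero, zero_add, pow_zero, one_mul]
    congr 1
    push_cast
    ring
  | succ j ih =>
    rw [pow_succ' _ (j + 1), mul_assoc,
      laplacian_quadPoly_mul ((isHomogeneous_quadPoly.pow (j + 1)).mul hl), ih, mul_smul_comm,
      ← mul_assoc, ← pow_succ', ← add_smul]
    congr 1
    push_cast
    ring

variable [CharZero K]

/-- The degree `N` part of `(1 - 2∑ vᵢXᵢ + (∑ vᵢ²)(∑ Xᵢ²))^(-ν)`. -/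
noncomputable def zonal (ν : K) (v : σ → K) (N : ℕ) : MvPolynomial σ K :=
  gegenbauer ν (linPoly v) (C (∑ i, v i ^ 2) * quadPoly σ K) N

theorem eval_zonal (ν : K) (v z : σ → K) (N : ℕ) :
    eval z (zonal ν v N) = gegenbauer ν (∑ i, v i * z i) ((∑ i, v i ^ 2) * ∑ i, z i ^ 2) N := by
  have h := map_gegenbauer (aeval z : MvPolynomial σ K →ₐ[K] K) ν (linPoly v)
    (C (∑ i, v i ^ 2) * quadPoly σ K) N
  rwa [aeval_eq_eval, map_mul, eval_C, eval_linPoly, eval_quadPoly] at h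

theorem laplacian_zonal (ν : K) (v : σ → K) (N : ℕ) :
    laplacian (zonal ν v N) = if 2 ≤ N then
      (4 * ν * (ν + 1 - Fintype.card σ / 2) * ∑ i, v i ^ 2) • zonal (ν + 1) v (N - 2) else 0 := by
  set Q := ∑ i, v i ^ 2 with hQ
  have hp (i : σ) : pderiv i (C Q * quadPoly σ K) = 2 * C Q * X i := by
    rw [pderiv_C_mul, pderiv_quadPoly]
    ring
  have key := congrArg (PowerSeries.coeff N)
    (sum_coeffDerivation_coeffDerivation_gegenbauerSeries (pderiv (R := K))
      (s := linPoly v) (p := C Q * quadPoly σ K) (A := C Q) (d := Fintype.card σ / 2)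
      ?_ ?_ ?_ ?_ ?_ ν)
  · rw [PowerSeries.coeff_mul_X_pow', PowerSeries.coeff_C_mul, map_sum] at key
    simp only [coeff_coeffDerivation] at key
    rw [laplacian_apply]
    refine key.trans (if_congr Iff.rfl ?_ rfl)
    rw [mul_smul _ Q, smul_mul_assoc, ← smul_eq_C_mul]
    rfl
  · simp [pderiv_linPoly, hQ]
  · simp only [pderiv_linPoly, hp]
    rw [linPoly, Finset.mul_sum]
    exact Finset.sum_congr rfl fun i _ => by ring
  · simp only [hp]
    rw [quadPoly, Finset.mul_sum, Finset.mul_sum]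
    exact Finset.sum_congr rfl fun i _ => by ring
  · simp [pderiv_linPoly]
  · rw [mul_div_left_comm, show (4 / 2 : K) = 2 by norm_num, smul_eq_C_mul]
    simp only [hp, Derivation.leibniz, pderiv_X_self, smul_eq_mul, mul_one, derivation_C, mul_zero,
      derivation_two, add_zero, Finset.sum_const, Finset.card_univ, nsmul_eq_mul, C_mul,
      map_natCast, map_ofNat C]
    ring

theorem quadPoly_dvd_zonal_sub (ν : K) (v : σ → K) (N : ℕ) :
    quadPoly σ K ∣ zonal ν v N - Ring.multichoose ν N • (2 * linPoly v) ^ N :=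
  (dvd_mul_left _ _).trans (dvd_gegenbauer_sub_smul_pow ν _ _ N)

theorem isHomogeneous_zonal (ν : K) (v : σ → K) (N : ℕ) : (zonal ν v N).IsHomogeneous N := by
  rw [zonal, gegenbauer, gegenbauerSeries, powOneAdd, PowerSeries.coeff_subst'
    (.of_constantCoeff_zero' (constantCoeff_gegenbauerBase _ _)), ← mem_homogeneousSubmodule]
  refine finsum_induction (· ∈ homogeneousSubmodule σ K N) (zero_mem _) (fun _ _ => add_mem)
    fun d => Submodule.smul_mem _ _ (isHomogeneous_coeff_pow (fun M => ?_) d N)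
  have hC {f : MvPolynomial σ K} {l : ℕ} (hf : f.IsHomogeneous l) :
      (PowerSeries.coeff M (PowerSeries.C f * PowerSeries.X ^ l)).IsHomogeneous M := by
    rw [PowerSeries.coeff_C_mul_X_pow]
    split_ifs with hM
    · exact hM ▸ hf
    · exact isHomogeneous_zero σ K M
  have hX : 2 * PowerSeries.C (linPoly v) * PowerSeries.X =
      PowerSeries.C (C 2 * linPoly v) * PowerSeries.X ^ 1 := by
    rw [map_mul, map_ofNat C, map_ofNat PowerSeries.C, pow_one]
  rw [hX, map_sub]
  exact (hC (isHomogeneous_quadPoly.C_mul _)).sub (hC ((isHomogeneous_linPoly v).C_mul 2))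

end Zonal

section Fischer

open MvPolynomial ComplexConjugate ComplexOrder

variable {σ : Type*}

/-- The Fischer inner product `∑ a! conj(pₐ) rₐ` of polynomials, for which multiplication by a
variable is adjoint to the derivative in that variable. -/
noncomputable def fischer : MvPolynomial σ ℂ →ₗ⋆[ℂ] MvPolynomial σ ℂ →ₗ[ℂ] ℂ :=
  LinearMap.mk₂'ₛₗ _ _
    (fun p r => ∑ a ∈ p.support,
      (a.prod fun _ m => (m.factorial : ℂ)) * (conj (coeff a p) * coeff a r))
    (fun p p' r => by
      classical
      have hsum (f : MvPolynomial σ ℂ) (hf : f.support ⊆ p.support ∪ p'.support) :=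
        Finset.sum_subset hf
          (f := fun a => (a.prod fun _ m => (m.factorial : ℂ)) * (conj (coeff a f) * coeff a r))
          fun a _ ha => by simp [notMem_support_iff.1 ha]
      rw [hsum _ support_add, hsum p Finset.subset_union_left,
        hsum p' Finset.subset_union_right, ← Finset.sum_add_distrib]
      simp only [coeff_add, map_add, add_mul, mul_add])
    (fun c p r => by
      rw [Finset.sum_subset (support_smul (a := c)) fun a _ ha => by
        rw [notMem_support_iff.1 ha, map_zero, zero_mul, mul_zero], Finset.smul_sum]
      refine Finset.sum_congr rfl fun a _ => ?_
      simp only [coeff_smul, smul_eq_mul, map_mul]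
      ring)
    (fun p r r' => by simp only [coeff_add, mul_add, Finset.sum_add_distrib])
    (fun c p r => by
      simp only [coeff_smul, RingHom.id_apply, smul_eq_mul, Finset.mul_sum, mul_left_comm c])

theorem fischer_apply (p r : MvPolynomial σ ℂ) : fischer p r = ∑ a ∈ p.support,
    (a.prod fun _ m => (m.factorial : ℂ)) * (conj (coeff a p) * coeff a r) :=
  rfl

theorem fischer_monomial (a : σ →₀ ℕ) (c : ℂ) (r : MvPolynomial σ ℂ) :
    fischer (monomial a c) r =
      (a.prod fun _ m => (m.factorial : ℂ)) * (conj c * coeff a r) := by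
  classical
  rw [fischer_apply, Finset.sum_subset support_monomial_subset fun b _ hb => by
    rw [notMem_support_iff.1 hb, map_zero, zero_mul, mul_zero], Finset.sum_singleton,
    coeff_monomial, if_pos rfl]

theorem fischer_self_term_nonneg (a : σ →₀ ℕ) (c : ℂ) :
    0 ≤ (a.prod fun _ m => (m.factorial : ℂ)) * (conj c * c) := by
  rw [Finsupp.prod, ← Nat.cast_prod]
  exact mul_nonneg (Nat.cast_nonneg _) (star_mul_self_nonneg c)

theorem isPosSemidef_fischer : (fischer (σ := σ)).IsPosSemidef where
  eq p r := by
    classical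
    have hinter {f g : MvPolynomial σ ℂ} : fischer f g = ∑ a ∈ f.support ∩ g.support,
        (a.prod fun _ m => (m.factorial : ℂ)) * (conj (coeff a f) * coeff a g) := by
      refine (Finset.sum_subset Finset.inter_subset_left fun a ha ha' => ?_).symm
      rw [notMem_support_iff.1 fun h => ha' (Finset.mem_inter.2 ⟨ha, h⟩), mul_zero, mul_zero]
    rw [hinter, hinter, map_sum, Finset.inter_comm]
    refine Finset.sum_congr rfl fun a _ => ?_
    simp only [Finsupp.prod, map_mul, map_prod, map_natCast, Complex.conj_conj]
    ring
  nonneg p := Finset.sum_nonneg fun a _ => fischer_self_term_nonneg a (coeff a p)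

theorem eq_zero_of_fischer_self_eq_zero {p : MvPolynomial σ ℂ} (hp : fischer p p = 0) :
    p = 0 := by
  rw [fischer_apply, Finset.sum_eq_zero_iff_of_nonneg fun a _ => fischer_self_term_nonneg a _] at hp
  ext a
  by_contra ha
  have hfac : (a.prod fun _ m => (m.factorial : ℂ)) ≠ 0 :=
    Finset.prod_ne_zero_iff.2 fun i _ => Nat.cast_ne_zero.2 (Nat.factorial_ne_zero _)
  simpa [hfac, mem_support_iff.1 (mem_support_iff.2 ha)] using hp a (mem_support_iff.2 ha)

theorem fischer_X_mul (i : σ) (p r : MvPolynomial σ ℂ) :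
    fischer (X i * p) r = fischer p (pderiv i r) := by
  classical
  induction p using MvPolynomial.induction_on' with
  | add p p' hp hp' => rw [mul_add, map_add, map_add, LinearMap.add_apply, hp, hp']; rfl
  | monomial a c =>
    have hfac : ((a + Finsupp.single i 1).prod fun _ m => (m.factorial : ℂ)) =
        (a i + 1) * a.prod fun _ m => (m.factorial : ℂ) := by
      rw [← Finsupp.mul_prod_erase' _ i _ fun _ => by simp,
        ← Finsupp.mul_prod_erase' a i _ fun _ => by simp, Finsupp.erase_add, Finsupp.erase_single,
        add_zero, Finsupp.add_apply, Finsupp.single_eq_same, Nat.factorial_succ]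
      push_cast
      ring
    rw [X, monomial_mul, add_comm, one_mul, fischer_monomial, fischer_monomial, hfac, coeff_pderiv]
    ring

variable [Fintype σ]

theorem fischer_quadPoly_mul (p r : MvPolynomial σ ℂ) :
    fischer (quadPoly σ ℂ * p) r = fischer p (laplacian r) := by
  simp only [quadPoly, laplacian_apply, Finset.sum_mul, map_sum, LinearMap.sum_apply, sq, mul_assoc,
    fischer_X_mul]

theorem eq_zero_of_quadPoly_dvd_of_laplacian_eq_zero {f : MvPolynomial σ ℂ}
    (hdvd : quadPoly σ ℂ ∣ f) (hf : laplacian f = 0) : f = 0 := by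
  obtain ⟨g, rfl⟩ := hdvd
  refine eq_zero_of_fischer_self_eq_zero ?_
  rw [fischer_quadPoly_mul, hf, map_zero]

theorem fischer_linPoly_pow (w : σ → ℂ) {h : MvPolynomial σ ℂ} {l : ℕ} (hh : h.IsHomogeneous l) :
    fischer (linPoly (star w) ^ l) h = l.factorial * eval w h := by
  induction l generalizing h with
  | zero =>
    obtain ⟨c, rfl⟩ : ∃ c, h = C c := ⟨_, totalDegree_eq_zero_iff_eq_C.1 (by
      simpa using hh.totalDegree_le)⟩
    rw [pow_zero, ← C_1, C_apply, fischer_monomial]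
    simp
  | succ l ih =>
    have hterm (i : σ) : fischer (C (star w i) * X i * linPoly (star w) ^ l) h =
        w i * (l.factorial * eval w (pderiv i h)) := by
      rw [mul_assoc, ← smul_eq_C_mul, LinearMap.map_smulₛₗ, LinearMap.smul_apply, fischer_X_mul,
        ih hh.pderiv]
      simp
    have heuler := congrArg (eval w) hh.sum_X_mul_pderiv
    simp only [map_sum, map_mul, eval_X, nsmul_eq_mul, map_natCast] at heuler
    have hsplit : linPoly (star w) ^ (l + 1) =
        ∑ i, C (star w i) * X i * linPoly (star w) ^ l := by
      rw [pow_succ', ← Finset.sum_mul]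
      rfl
    simp only [hsplit, map_sum, LinearMap.sum_apply, hterm]
    rw [Nat.factorial_succ, Nat.cast_mul, mul_right_comm, ← heuler, Finset.sum_mul]
    exact Finset.sum_congr rfl fun i _ => by ring

theorem fischer_zonal (ν : ℂ) (w : σ → ℂ) {h : MvPolynomial σ ℂ} {l : ℕ}
    (hl : h.IsHomogeneous l) (hh : laplacian h = 0) :
    fischer (zonal ν (star w) l) h =
      conj (Ring.multichoose ν l) * (2 ^ l * l.factorial) * eval w h := by
  obtain ⟨g, hg⟩ := quadPoly_dvd_zonal_sub ν (star w) l
  have h2 : (2 * linPoly (star w)) ^ l = (2 ^ l : ℂ) • linPoly (star w) ^ l := by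
    rw [mul_pow, smul_eq_C_mul, map_pow, map_ofNat C]
  rw [sub_eq_iff_eq_add.1 hg, map_add, LinearMap.add_apply, fischer_quadPoly_mul, hh, map_zero, h2,
    smul_smul, LinearMap.map_smulₛₗ, LinearMap.smul_apply, fischer_linPoly_pow w hl]
  simp [mul_assoc, map_ofNat]

end Fischer

section Expansion

theorem multichoose_pos {x : ℝ} (hx : 0 < x) (N : ℕ) : 0 < Ring.multichoose x N := by
  have h := Ring.factorial_nsmul_multichoose_eq_ascPochhammer x N
  rw [Polynomial.ascPochhammer_smeval_eq_eval, nsmul_eq_mul] at h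
  exact pos_of_mul_pos_right (h ▸ ascPochhammer_pos N x hx) (Nat.cast_nonneg _)

theorem multichoose_ofReal (x : ℝ) (N : ℕ) :
    Ring.multichoose (x : ℂ) N = (Ring.multichoose x N : ℝ) :=
  (Ring.map_multichoose Complex.ofRealHom x N).symm

variable {σ : Type*} [Fintype σ]

theorem eq_of_quadPoly_dvd_sub_of_laplacian_eq {f g : MvPolynomial σ ℂ}
    (hdvd : quadPoly σ ℂ ∣ f - g) (hΔ : laplacian f = laplacian g) : f = g :=
  sub_eq_zero.1 <| eq_zero_of_quadPoly_dvd_of_laplacian_eq_zero hdvd <| by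
    rw [map_sub, hΔ, sub_self]

theorem laplacian_zonal_eq_zero {μ : ℝ} (hμ : μ = Fintype.card σ / 2 - 1) (v : σ → ℂ) (N : ℕ) :
    laplacian (zonal (μ : ℂ) v N) = 0 := by
  rw [laplacian_zonal, hμ]
  push_cast
  simp

theorem quadPoly_dvd_zonal_sub_smul_zonal (ν : ℝ) {μ : ℝ} (hμ : 0 < μ) (v : σ → ℂ) (N : ℕ) :
    quadPoly σ ℂ ∣ zonal (ν : ℂ) v N -
      ((Ring.multichoose ν N / Ring.multichoose μ N : ℝ) : ℂ) • zonal (μ : ℂ) v N := by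
  set a : ℂ := ((Ring.multichoose ν N / Ring.multichoose μ N : ℝ) : ℂ) with ha
  have hmul : a * Ring.multichoose (μ : ℂ) N = Ring.multichoose (ν : ℂ) N := by
    rw [ha, multichoose_ofReal, multichoose_ofReal, ← Complex.ofReal_mul,
      div_mul_cancel₀ _ (multichoose_pos hμ N).ne']
  have h := dvd_sub (quadPoly_dvd_zonal_sub (ν : ℂ) v N)
    ((quadPoly_dvd_zonal_sub (μ : ℂ) v N).trans (dvd_smul_of_dvd a dvd_rfl))
  rwa [smul_sub, smul_smul, hmul, sub_sub_sub_cancel_right] at h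

theorem zonal_eq_smul_zonal_of_lt_two (ν : ℝ) {μ : ℝ} (hμ : μ = Fintype.card σ / 2 - 1)
    (hμ0 : 0 < μ) (v : σ → ℂ) {N : ℕ} (hN : N < 2) : zonal (ν : ℂ) v N =
      ((Ring.multichoose ν N / Ring.multichoose μ N : ℝ) : ℂ) • zonal (μ : ℂ) v N :=
  eq_of_quadPoly_dvd_sub_of_laplacian_eq (quadPoly_dvd_zonal_sub_smul_zonal ν hμ0 v N) <| by
    rw [map_smul, laplacian_zonal_eq_zero hμ, laplacian_zonal, if_neg hN.not_ge, smul_zero]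

theorem zonal_add_two_eq_smul_zonal_add_sum {ν μ : ℝ} (hμ : μ = Fintype.card σ / 2 - 1)
    (hμ0 : 0 < μ) (v : σ → ℂ) {N : ℕ} {s : Finset ℕ} {c : ℕ → ℝ}
    (h : zonal ((ν + 1 : ℝ) : ℂ) v N = ∑ j ∈ s, (c j * (∑ i, v i ^ 2) ^ j : ℂ) •
      (quadPoly σ ℂ ^ j * zonal (μ : ℂ) v (N - 2 * j))) :
    zonal (ν : ℂ) v (N + 2) =
      ((Ring.multichoose ν (N + 2) / Ring.multichoose μ (N + 2) : ℝ) : ℂ) •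
        zonal (μ : ℂ) v (N + 2) +
      ∑ j ∈ s, ((4 * ν * (ν - μ) * c j /
          (2 * (j + 1) * (2 * j + Fintype.card σ + 2 * (N - 2 * j : ℕ))) : ℝ) *
          (∑ i, v i ^ 2) ^ (j + 1) : ℂ) •
        (quadPoly σ ℂ ^ (j + 1) * zonal (μ : ℂ) v (N - 2 * j)) := by
  refine eq_of_quadPoly_dvd_sub_of_laplacian_eq ?_ ?_
  · rw [← sub_sub]
    exact dvd_sub (quadPoly_dvd_zonal_sub_smul_zonal ν hμ0 v (N + 2)) <|
      Finset.dvd_sum fun j _ => dvd_smul_of_dvd _ <|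
        dvd_mul_of_dvd_left (dvd_pow_self _ j.succ_ne_zero) _
  · have hcard : (0 : ℝ) < Fintype.card σ := by linarith
    rw [map_add, map_smul, laplacian_zonal_eq_zero hμ, smul_zero, zero_add, laplacian_zonal,
      if_pos le_add_self, Nat.add_sub_cancel, ← Complex.ofReal_one, ← Complex.ofReal_add, h,
      Finset.smul_sum, map_sum]
    refine Finset.sum_congr rfl fun j _ => ?_
    have hpos : (2 * j + Fintype.card σ + 2 * (N - 2 * j : ℕ) : ℂ) ≠ 0 := by
      have : (0 : ℝ) < 2 * j + Fintype.card σ + 2 * (N - 2 * j : ℕ) := by positivity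
      exact_mod_cast this.ne'
    rw [map_smul, laplacian_quadPoly_pow_mul (isHomogeneous_zonal _ _ _)
      (laplacian_zonal_eq_zero hμ v _), smul_smul, smul_smul, hμ]
    congr 1
    have hj : (j + 1 : ℂ) ≠ 0 := Nat.cast_add_one_ne_zero j
    push_cast
    field_simp
    ring

theorem exists_zonal_eq_sum_smul_quadPoly_pow_mul_zonal {ν μ : ℝ}
    (hμ : μ = Fintype.card σ / 2 - 1) (hμ0 : 0 < μ) (hν : μ < ν) (N : ℕ) :
    ∃ c : ℕ → ℝ, (∀ j, 0 ≤ c j) ∧ ∀ v : σ → ℂ, zonal (ν : ℂ) v N =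
      ∑ j ∈ Finset.range (N / 2 + 1),
        (c j * (∑ i, v i ^ 2) ^ j : ℂ) • (quadPoly σ ℂ ^ j * zonal (μ : ℂ) v (N - 2 * j)) := by
  have ha (N : ℕ) {ν : ℝ} (hν : μ < ν) : 0 ≤ Ring.multichoose ν N / Ring.multichoose μ N :=
    (div_pos (multichoose_pos (hμ0.trans hν) N) (multichoose_pos hμ0 N)).le
  induction N using Nat.twoStepInduction generalizing ν with
  | zero =>
    exact ⟨fun _ => _, fun _ => ha 0 hν, fun v => by
      simp [zonal_eq_smul_zonal_of_lt_two ν hμ hμ0 v two_pos]⟩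
  | one =>
    exact ⟨fun _ => _, fun _ => ha 1 hν, fun v => by
      simp [zonal_eq_smul_zonal_of_lt_two ν hμ hμ0 v one_lt_two]⟩
  | more N ih _ =>
    obtain ⟨c, hc, hexp⟩ := ih (hν.trans (lt_add_one ν))
    refine ⟨fun
      | 0 => Ring.multichoose ν (N + 2) / Ring.multichoose μ (N + 2)
      | j + 1 => 4 * ν * (ν - μ) * c j /
          (2 * (j + 1) * (2 * j + Fintype.card σ + 2 * (N - 2 * j : ℕ))), fun j => ?_, fun v => ?_⟩
    · cases j with
      | zero => exact ha (N + 2) hν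
      | succ j =>
        exact div_nonneg (mul_nonneg (mul_pos (mul_pos four_pos (hμ0.trans hν))
          (sub_pos.2 hν)).le (hc j)) (by positivity)
    · rw [zonal_add_two_eq_smul_zonal_add_sum hμ hμ0 v (hexp v), Nat.add_div_right _ two_pos,
        Finset.sum_range_succ' _ (N / 2 + 1), add_comm]
      simp only [pow_zero, mul_one, one_mul, mul_zero, Nat.sub_zero, mul_add,
        Nat.add_sub_add_right]

end Expansion

section PosSemidef

open ComplexOrder

variable {X : Type*}

theorem posSemidef_of_isPosSemidef {E : Type*} [AddCommGroup E] [Module ℂ E]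
    {B : E →ₗ⋆[ℂ] E →ₗ[ℂ] ℂ} (hB : B.IsPosSemidef) (Φ : X → E) :
    (Matrix.of fun x y => B (Φ x) (Φ y)).PosSemidef := by
  refine ⟨.ext fun x y => hB.1.eq _ _, fun c => ?_⟩
  have h : (c.sum fun x a => c.sum fun y b => star a * B (Φ x) (Φ y) * b) =
      B (c.sum fun x a => a • Φ x) (c.sum fun x a => a • Φ x) := by
    simp only [Finsupp.sum, map_sum, LinearMap.sum_apply, LinearMap.map_smulₛₗ,
      LinearMap.smul_apply, smul_eq_mul, RingHom.id_apply, Finset.mul_sum]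
    rw [Finset.sum_comm]
    exact Finset.sum_congr rfl fun y _ => Finset.sum_congr rfl fun x _ => by
      rw [mul_comm, starRingEnd_apply]
  exact h ▸ hB.2.nonneg _

theorem posSemidef_gram {E : Type*} [NormedAddCommGroup E] [InnerProductSpace ℂ E] (v : X → E) :
    (Matrix.gram ℂ v).PosSemidef :=
  posSemidef_of_isPosSemidef (B := innerₛₗ ℂ)
    { eq := fun _ _ => inner_conj_symm _ _
      nonneg := fun x => by
        rw [innerₛₗ_apply_apply, inner_self_eq_norm_sq_to_K]
        exact pow_nonneg (Complex.zero_le_real.2 (norm_nonneg x)) 2 } v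

theorem posSemidef_of_hasSum {ι : Type*} {M : ι → Matrix X X ℂ} {A : Matrix X X ℂ}
    (hM : ∀ i, (M i).PosSemidef) (hA : ∀ x y, HasSum (fun i => M i x y) (A x y)) :
    A.PosSemidef := by
  refine ⟨.ext fun x y => ?_, fun c => ?_⟩
  · refine HasSum.unique ?_ (hA x y)
    simpa only [(hM _).1.apply] using (hA y x).star
  · exact (hasSum_sum fun x _ => hasSum_sum fun y _ =>
      ((hA x y).mul_left (star (c x))).mul_right (c y)).nonneg fun i => (hM i).2 c

theorem posSemidef_smul_id {M : Matrix X X ℂ} (hM : M.PosSemidef) :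
    (Matrix.of fun x y => M x y • ContinuousLinearMap.id ℂ ℂ :
      Matrix X X (ℂ →L[ℂ] ℂ)).PosSemidef := by
  have hiff := (RKHS.posSemidef_tfae (𝕜 := ℂ) (V := ℂ)
    (K := Matrix.of fun x y => M x y • ContinuousLinearMap.id ℂ ℂ)).out 0 2
  refine hiff.2 ⟨.ext fun x y => ?_, fun c => ?_⟩
  · have hid : star (ContinuousLinearMap.id ℂ ℂ) = ContinuousLinearMap.id ℂ ℂ :=
      ContinuousLinearMap.adjoint_id
    rw [Matrix.of_apply, Matrix.of_apply, star_smul, hid, hM.1.apply]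
  · refine (Complex.le_def.1 (hM.2 c)).1.trans_eq (congrArg Complex.re ?_)
    refine Finsupp.sum_congr fun x _ => Finsupp.sum_congr fun y _ => ?_
    simp only [Matrix.of_apply, smul_apply, ContinuousLinearMap.id_apply,
      smul_eq_mul, RCLike.inner_apply, map_mul, starRingEnd_apply, hM.1.apply]
    ring

end PosSemidef

section ZonalKernel

open MvPolynomial ComplexOrder

variable {σ : Type*} [Fintype σ]

theorem posSemidef_eval_zonal_of_eq {μ : ℝ} (hμ : μ = Fintype.card σ / 2 - 1) (hμ0 : 0 < μ)
    (N : ℕ) : (Matrix.of fun z w : σ → ℂ => eval z (zonal (μ : ℂ) (star w) N)).PosSemidef := by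
  have hC : 0 < Ring.multichoose μ N * (2 ^ N * N.factorial) :=
    mul_pos (multichoose_pos hμ0 N) (by positivity)
  have h := (posSemidef_of_isPosSemidef isPosSemidef_fischer
    fun w : σ → ℂ => zonal (μ : ℂ) (star w) N).smul (inv_nonneg.2 hC.le)
  convert h using 1
  ext z w
  rw [Matrix.smul_apply, Matrix.of_apply, Matrix.of_apply, fischer_zonal _ _
    (isHomogeneous_zonal _ _ _) (laplacian_zonal_eq_zero hμ _ N), multichoose_ofReal,
    Complex.conj_ofReal, Complex.real_smul, ← mul_assoc]
  rw_mod_cast [inv_mul_cancel₀ hC.ne']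
  rw [Complex.ofReal_one, one_mul]

theorem posSemidef_eval_zonal {ν μ : ℝ} (hμ : μ = Fintype.card σ / 2 - 1) (hμ0 : 0 < μ)
    (hν : μ < ν) (N : ℕ) :
    (Matrix.of fun z w : σ → ℂ => eval z (zonal (ν : ℂ) (star w) N)).PosSemidef := by
  obtain ⟨c, hc, hexp⟩ := exists_zonal_eq_sum_smul_quadPoly_pow_mul_zonal hμ hμ0 hν N
  have h (j : ℕ) := ((posSemidef_gram
    fun z : σ → ℂ => star ((∑ i, z i ^ 2) ^ j)).hadamard
      (posSemidef_eval_zonal_of_eq hμ hμ0 (N - 2 * j))).smul (hc j)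
  have hsum := Matrix.posSemidef_sum (Finset.range (N / 2 + 1)) fun j _ => h j
  refine Eq.subst (Matrix.ext fun z w => ?_) hsum
  simp only [Matrix.of_apply, Matrix.sum_apply, Matrix.smul_apply, Matrix.hadamard_apply,
    Matrix.gram_apply, RCLike.inner_apply, hexp, map_sum, smul_eval, map_mul, map_pow,
    eval_quadPoly, Complex.real_smul, Pi.star_apply, star_pow, star_sum, starRingEnd_apply,
    star_star]
  exact Finset.sum_congr rfl fun j _ => by ring

end ZonalKernel

section GegenbauerSum

theorem hasSum_choose_mul_pow (r : ℂ) {a : ℂ} (ha : ‖a‖ < 1) :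
    HasSum (fun N => Ring.choose r N * a ^ N) ((1 + a) ^ r) := by
  have ha' : a ∈ Metric.eball (0 : ℂ) 1 := by simpa [← ofReal_norm] using ha
  simpa [binomialSeries, mul_comm] using
    (Complex.one_add_cpow_hasFPowerSeriesOnBall_zero (a := r)).hasSum ha'

theorem mul_cpow_of_re_pos {a b : ℂ} (ha : 0 < a.re) (hb : 0 < b.re) (r : ℂ) :
    (a * b) ^ r = a ^ r * b ^ r := by
  have ha_arg := abs_lt.1 (Complex.abs_arg_lt_pi_div_two_iff.2 (.inl ha))
  have hb_arg := abs_lt.1 (Complex.abs_arg_lt_pi_div_two_iff.2 (.inl hb))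
  have hane : a ≠ 0 := by rintro rfl; simp at ha
  have hbne : b ≠ 0 := by rintro rfl; simp at hb
  rw [Complex.cpow_def_of_ne_zero (mul_ne_zero hane hbne), Complex.cpow_def_of_ne_zero hane,
    Complex.cpow_def_of_ne_zero hbne, Complex.log_mul hane hbne ⟨by linarith, by linarith⟩,
    add_mul, Complex.exp_add]

theorem hasSum_gegenbauer (ν : ℂ) {α β s p : ℂ} (hs : α + β = 2 * s) (hp : α * β = p)
    (hα : ‖α‖ < 1) (hβ : ‖β‖ < 1) : HasSum (gegenbauer ν s p) ((1 - 2 * s + p) ^ (-ν)) := by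
  have hre {x : ℂ} (hx : ‖x‖ < 1) : 0 < (1 + -x).re := by
    rw [Complex.add_re, Complex.one_re, Complex.neg_re]
    linarith [Complex.re_le_norm x]
  have hα' := hasSum_choose_mul_pow (-ν) (norm_neg α ▸ hα)
  have hβ' := hasSum_choose_mul_pow (-ν) (norm_neg β ▸ hβ)
  have hcauchy : gegenbauer ν s p = fun N => ∑ kl ∈ Finset.HasAntidiagonal.antidiagonal N,
      Ring.choose (-ν) kl.1 * (-α) ^ kl.1 * (Ring.choose (-ν) kl.2 * (-β) ^ kl.2) := by
    ext N
    simp only [gegenbauer, gegenbauerSeries_eq_powOneAdd_mul_powOneAdd ν hs hp,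
      PowerSeries.coeff_mul, ← neg_mul, ← map_neg, coeff_powOneAdd_C_mul_X, smul_eq_mul]
  have hprod : 1 - 2 * s + p = (1 + -α) * (1 + -β) := by
    rw [← hs, ← hp]
    ring
  rw [hcauchy, hprod, mul_cpow_of_re_pos (hre hα) (hre hβ), ← hα'.tsum_eq, ← hβ'.tsum_eq,
    tsum_mul_tsum_eq_tsum_sum_antidiagonal_of_summable_norm hα'.summable.norm hβ'.summable.norm]
  exact (summable_norm_sum_mul_antidiagonal_of_summable_norm hα'.summable.norm
    hβ'.summable.norm).of_norm.hasSum

end GegenbauerSum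

section LieBall

open ComplexConjugate ComplexOrder

theorem norm_inner_mul_inner_sub_sq_le {E : Type*} [NormedAddCommGroup E] [InnerProductSpace ℂ E]
    (x y u v : E) :
    ‖inner ℂ x u * inner ℂ y v - inner ℂ x v * inner ℂ y u‖ ^ 2 ≤
      (‖x‖ ^ 2 * ‖y‖ ^ 2 - ‖inner ℂ x y‖ ^ 2) * (‖u‖ ^ 2 * ‖v‖ ^ 2 - ‖inner ℂ u v‖ ^ 2) := by
  have hinner (x y u v : E) : inner ℂ (x ⊗ₜ[ℂ] y - y ⊗ₜ x) (u ⊗ₜ[ℂ] v - v ⊗ₜ u) =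
      2 * (inner ℂ x u * inner ℂ y v - inner ℂ x v * inner ℂ y u) := by
    simp only [inner_sub_left, inner_sub_right, TensorProduct.inner_tmul]
    ring
  have hnorm (x y : E) : ‖x ⊗ₜ[ℂ] y - y ⊗ₜ x‖ ^ 2 =
      2 * (‖x‖ ^ 2 * ‖y‖ ^ 2 - ‖inner ℂ x y‖ ^ 2) := by
    have h := (inner_self_eq_norm_sq_to_K (𝕜 := ℂ) (x ⊗ₜ[ℂ] y - y ⊗ₜ x)).symm.trans
      (hinner x y x y)
    rw [inner_self_eq_norm_sq_to_K, inner_self_eq_norm_sq_to_K, ← inner_conj_symm y x,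
      Complex.mul_conj'] at h
    exact Complex.ofReal_injective (by push_cast; exact h)
  have h := pow_le_pow_left₀ (norm_nonneg _)
    (norm_inner_le_norm (𝕜 := ℂ) (x ⊗ₜ[ℂ] y - y ⊗ₜ x) (u ⊗ₜ[ℂ] v - v ⊗ₜ u)) 2
  rw [hinner, mul_pow, hnorm, hnorm, norm_mul, mul_pow, Complex.norm_two] at h
  linarith

variable {n : ℕ}

/-- The coordinatewise conjugate of a vector; it turns the bilinear form `∑ zᵢ wᵢ` into the inner
product `⟪conjVec z, w⟫`. -/
noncomputable def conjVec (z : EuclideanSpace ℂ (Fin n)) : EuclideanSpace ℂ (Fin n) :=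
  WithLp.toLp 2 fun i => conj (z i)

theorem norm_conjVec (z : EuclideanSpace ℂ (Fin n)) : ‖conjVec z‖ = ‖z‖ := by
  simp [conjVec, EuclideanSpace.norm_eq]

theorem inner_conjVec_left (z w : EuclideanSpace ℂ (Fin n)) :
    inner ℂ (conjVec z) w = conj (inner ℂ z (conjVec w)) := by
  simp [conjVec, PiLp.inner_apply, mul_comm]

theorem inner_conjVec_right_comm (z w : EuclideanSpace ℂ (Fin n)) :
    inner ℂ z (conjVec w) = inner ℂ w (conjVec z) := by
  simp [conjVec, PiLp.inner_apply, mul_comm]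

theorem inner_conjVec_conjVec (z w : EuclideanSpace ℂ (Fin n)) :
    inner ℂ (conjVec z) (conjVec w) = inner ℂ w z := by
  simp [conjVec, PiLp.inner_apply, mul_comm]

theorem inner_conjVec_self (z : EuclideanSpace ℂ (Fin n)) :
    inner ℂ (conjVec z) z = quadForm z := by
  simp [conjVec, PiLp.inner_apply, quadForm, sq]

theorem inner_self_conjVec (z : EuclideanSpace ℂ (Fin n)) :
    inner ℂ z (conjVec z) = conj (quadForm z) := by
  rw [← inner_conjVec_self, inner_conj_symm]

theorem lieH_eq_inner (z w : EuclideanSpace ℂ (Fin n)) :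
    lieH z w = 1 - 2 * inner ℂ w z + quadForm z * conj (quadForm w) := by
  simp [lieH, PiLp.inner_apply]

theorem norm_inner_sq_sub_quadForm_le (z w : EuclideanSpace ℂ (Fin n)) :
    ‖inner ℂ w z ^ 2 - quadForm z * conj (quadForm w)‖ ≤
      ‖z‖ ^ 2 * ‖w‖ ^ 2 - ‖inner ℂ z (conjVec w)‖ ^ 2 := by
  have h := norm_inner_mul_inner_sub_sq_le w (conjVec z) z (conjVec w)
  rw [inner_conjVec_conjVec, inner_self_conjVec, inner_conjVec_self, inner_conjVec_right_comm w z,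
    norm_conjVec, norm_conjVec, mul_comm (‖w‖ ^ 2), ← sq, ← sq, mul_comm (conj _)] at h
  refine le_of_sq_le_sq h (sub_nonneg.2 ?_)
  rw [← mul_pow, ← norm_conjVec w]
  exact pow_le_pow_left₀ (norm_nonneg _) (norm_inner_le_norm _ _) 2

theorem norm_inner_sq_sub_norm_inner_conjVec_sq_le (z w : EuclideanSpace ℂ (Fin n)) :
    (‖inner ℂ w z‖ ^ 2 - ‖inner ℂ z (conjVec w)‖ ^ 2) ^ 2 ≤
      (‖z‖ ^ 4 - ‖quadForm z‖ ^ 2) * (‖w‖ ^ 4 - ‖quadForm w‖ ^ 2) := by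
  have h := norm_inner_mul_inner_sub_sq_le w (conjVec w) z (conjVec z)
  rw [inner_conjVec_conjVec, ← inner_conj_symm z w, inner_conjVec_left w z,
    inner_conjVec_right_comm w z, Complex.mul_conj', Complex.mul_conj', norm_conjVec, norm_conjVec,
    inner_self_conjVec, inner_self_conjVec, RCLike.norm_conj, RCLike.norm_conj] at h
  norm_cast at h
  rw [Real.norm_eq_abs, sq_abs] at h
  linarith

theorem norm_quadForm_le (z : EuclideanSpace ℂ (Fin n)) : ‖quadForm z‖ ≤ ‖z‖ ^ 2 := by
  rw [← inner_conjVec_self, sq]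
  exact (norm_inner_le_norm _ _).trans_eq (by rw [norm_conjVec])

theorem exists_sq_eq_of_mem_lieBall {z : EuclideanSpace ℂ (Fin n)} (hz : z ∈ lieBall n) :
    ∃ d, 0 ≤ d ∧ d ^ 2 = ‖z‖ ^ 4 - ‖quadForm z‖ ^ 2 ∧ d ≤ ‖z‖ ^ 2 ∧ ‖z‖ ^ 2 + d < 1 := by
  have hq := norm_quadForm_le z
  have hq0 := norm_nonneg (quadForm z)
  have hz1 : ‖z‖ ^ 2 < 1 := pow_lt_one₀ (norm_nonneg z) hz.2 two_ne_zero
  have hd : √(‖z‖ ^ 4 - ‖quadForm z‖ ^ 2) ^ 2 = ‖z‖ ^ 4 - ‖quadForm z‖ ^ 2 :=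
    Real.sq_sqrt (by nlinarith)
  refine ⟨_, Real.sqrt_nonneg _, hd, ?_, ?_⟩
  · exact Real.sqrt_le_iff.2 ⟨sq_nonneg _, by nlinarith⟩
  · rw [← lt_sub_iff_add_lt']
    exact (Real.sqrt_lt' (sub_pos.2 hz1)).2 (by linarith [hz.1])

theorem two_mul_norm_inner_sq_add_lt {z w : EuclideanSpace ℂ (Fin n)} (hz : z ∈ lieBall n)
    (hw : w ∈ lieBall n) :
    2 * (‖inner ℂ w z‖ ^ 2 + ‖inner ℂ w z ^ 2 - quadForm z * conj (quadForm w)‖) <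
      1 + ‖quadForm z * conj (quadForm w)‖ ^ 2 := by
  obtain ⟨d, hd0, hd, hdz, hd1⟩ := exists_sq_eq_of_mem_lieBall hz
  obtain ⟨e, he0, he, -, he1⟩ := exists_sq_eq_of_mem_lieBall hw
  have hsum := norm_inner_sq_sub_quadForm_le z w
  have hdiff : ‖inner ℂ w z‖ ^ 2 - ‖inner ℂ z (conjVec w)‖ ^ 2 ≤ d * e := by
    refine le_of_sq_le_sq ?_ (mul_nonneg hd0 he0)
    rw [mul_pow, hd, he]
    exact norm_inner_sq_sub_norm_inner_conjVec_sq_le z w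
  have hprod : ‖quadForm z * conj (quadForm w)‖ ^ 2 =
      (‖z‖ ^ 2 + d) * (‖z‖ ^ 2 - d) * ((‖w‖ ^ 2 + e) * (‖w‖ ^ 2 - e)) := by
    rw [norm_mul, RCLike.norm_conj, mul_pow]
    linear_combination (‖w‖ ^ 4 - e ^ 2) * hd + ‖quadForm z‖ ^ 2 * he
  have hplus : (‖z‖ ^ 2 + d) * (‖w‖ ^ 2 + e) < 1 :=
    mul_lt_one_of_nonneg_of_lt_one_left (by positivity) hd1 he1.le
  have hminus : (‖z‖ ^ 2 - d) * (‖w‖ ^ 2 - e) < 1 :=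
    mul_lt_one_of_nonneg_of_lt_one_left (sub_nonneg.2 hdz) (by linarith) (by linarith)
  rw [hprod]
  nlinarith [mul_pos (sub_pos.2 hplus) (sub_pos.2 hminus)]

theorem norm_lt_one_of_add_lt {α β : ℂ} (h1 : ‖α * β‖ < 1)
    (h2 : ‖α‖ ^ 2 + ‖β‖ ^ 2 < 1 + ‖α * β‖ ^ 2) : ‖α‖ < 1 := by
  by_contra! hα
  rw [norm_mul] at h1 h2
  have hβ : ‖β‖ < 1 := by nlinarith [norm_nonneg β]
  nlinarith [mul_nonneg (sub_nonneg.2 (one_le_pow₀ hα (n := 2)))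
    (sub_nonneg.2 (pow_le_one₀ (norm_nonneg β) hβ.le (n := 2)))]

theorem norm_quadForm_lt_one {z : EuclideanSpace ℂ (Fin n)} (hz : z ∈ lieBall n) :
    ‖quadForm z‖ < 1 :=
  (norm_quadForm_le z).trans_lt (pow_lt_one₀ (norm_nonneg z) hz.2 two_ne_zero)

theorem exists_roots_of_mem_lieBall {z w : EuclideanSpace ℂ (Fin n)} (hz : z ∈ lieBall n)
    (hw : w ∈ lieBall n) : ∃ α β : ℂ, α + β = 2 * inner ℂ w z ∧
      α * β = quadForm z * conj (quadForm w) ∧ ‖α‖ < 1 ∧ ‖β‖ < 1 := by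
  set s : ℂ := inner ℂ w z with hs
  set p := quadForm z * conj (quadForm w) with hp
  obtain ⟨d, hd⟩ := IsAlgClosed.exists_pow_nat_eq (s ^ 2 - p) two_pos
  have hprod : (s + d) * (s - d) = p := by linear_combination -hd
  have hsum : ‖s + d‖ ^ 2 + ‖s - d‖ ^ 2 < 1 + ‖(s + d) * (s - d)‖ ^ 2 := by
    have h := parallelogram_law_with_norm ℂ s d
    have hlt := two_mul_norm_inner_sq_add_lt hz hw
    rw [← hs, ← hp, ← hd, norm_pow] at hlt
    rw [hprod]
    nlinarith
  have hlt : ‖(s + d) * (s - d)‖ < 1 := by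
    rw [hprod, hp, norm_mul, RCLike.norm_conj]
    exact mul_lt_one_of_nonneg_of_lt_one_left (norm_nonneg _) (norm_quadForm_lt_one hz)
      (norm_quadForm_lt_one hw).le
  refine ⟨s + d, s - d, by ring, hprod, norm_lt_one_of_add_lt hlt hsum, ?_⟩
  exact norm_lt_one_of_add_lt (β := s + d) (by rwa [mul_comm]) (by rwa [add_comm, mul_comm (s - d)])

/-- The component of degree `N` of `h(z, w) ^ (-ν)`. -/
noncomputable def lieTerm (n : ℕ) (ν : ℂ) (N : ℕ) (z w : EuclideanSpace ℂ (Fin n)) : ℂ :=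
  MvPolynomial.eval z.ofLp (zonal ν (star w.ofLp) N)

theorem lieTerm_eq_gegenbauer (ν : ℂ) (N : ℕ) (z w : EuclideanSpace ℂ (Fin n)) :
    lieTerm n ν N z w = gegenbauer ν (inner ℂ w z) (quadForm z * conj (quadForm w)) N := by
  simp [lieTerm, eval_zonal, PiLp.inner_apply, quadForm, mul_comm]

theorem hasSum_lieTerm (ν : ℂ) {z w : EuclideanSpace ℂ (Fin n)} (hz : z ∈ lieBall n)
    (hw : w ∈ lieBall n) : HasSum (fun N => lieTerm n ν N z w) (lieH z w ^ (-ν)) := by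
  obtain ⟨α, β, hs, hp, hα, hβ⟩ := exists_roots_of_mem_lieBall hz hw
  simp only [lieTerm_eq_gegenbauer, lieH_eq_inner]
  exact hasSum_gegenbauer ν hs hp hα hβ

theorem posSemidef_lieTerm {ν μ : ℝ} (hμ : μ = n / 2 - 1) (hμ0 : 0 < μ) (hν : μ < ν)
    (N : ℕ) : (Matrix.of fun z w : lieBall n => lieTerm n ν N z w).PosSemidef :=
  (posSemidef_eval_zonal (σ := Fin n) (by simpa using hμ) hμ0 hν N).submatrix
    fun z : lieBall n => z.1.ofLp

theorem posSemidef_lieKernel {ν μ : ℝ} (hμ : μ = n / 2 - 1) (hμ0 : 0 < μ) (hν : μ < ν) :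
    (lieKernel n ν).PosSemidef :=
  posSemidef_smul_id (posSemidef_of_hasSum (posSemidef_lieTerm hμ hμ0 hν) fun z w =>
    hasSum_lieTerm ν z.2 w.2)

end LieBall

section FourierCoefficients

open MeasureTheory AddCircle

theorem continuous_of_continuous_inner {X E : Type*} [TopologicalSpace X] [NormedAddCommGroup E]
    [InnerProductSpace ℂ E] {φ : X → E} (h : Continuous fun p : X × X => inner ℂ (φ p.1) (φ p.2)) :
    Continuous φ := by
  refine continuous_iff_continuousAt.2 fun x => tendsto_iff_norm_sub_tendsto_zero.2 ?_
  have hdiag : Continuous fun y => inner ℂ (φ y) (φ y) :=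
    h.comp (continuous_id.prodMk continuous_id)
  have hleft : Continuous fun y => inner ℂ (φ y) (φ x) :=
    h.comp (continuous_id.prodMk continuous_const)
  have hright : Continuous fun y => inner ℂ (φ x) (φ y) :=
    h.comp (continuous_const.prodMk continuous_id)
  have hcont : Continuous fun y => √(inner ℂ (φ y - φ x) (φ y - φ x)).re := by
    simp only [inner_sub_left, inner_sub_right]
    fun_prop
  have hlim := hcont.tendsto x
  simp only [sub_self, inner_zero_left, Complex.zero_re, Real.sqrt_zero] at hlim
  exact hlim.congr fun y => (norm_eq_sqrt_re_inner (𝕜 := ℂ) _).symm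

variable {T : ℝ} [Fact (0 < T)] {E : Type*} [NormedAddCommGroup E]

theorem integral_fourier (n : ℤ) :
    ∫ t, fourier n t ∂(haarAddCircle (T := T)) = if n = 0 then 1 else 0 := by
  split_ifs with hn
  · simp [hn]
  · exact integral_eq_zero_of_add_right_eq_neg (fourier_add_half_inv_index hn Fact.out)

theorem integrable_of_continuous {f : AddCircle T → E} (hf : Continuous f) :
    Integrable f haarAddCircle :=
  hf.integrable_of_hasCompactSupport (.of_compactSpace f)

theorem fourierCoeff_fourier_smul [NormedSpace ℂ E] [CompleteSpace E] (m n : ℤ) (c : E) :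
    fourierCoeff (fun t : AddCircle T => fourier m t • c) n = if m = n then c else 0 := by
  simp only [fourierCoeff, smul_smul, ← fourier_add, integral_smul_const, integral_fourier,
    neg_add_eq_zero, eq_comm (a := n), ite_smul, one_smul, zero_smul]

theorem fourierCoeff_of_hasSum [NormedSpace ℂ E] [CompleteSpace E] {c : ℕ → E}
    (hc : Summable fun m => ‖c m‖) {f : AddCircle T → E}
    (hf : ∀ t, HasSum (fun m : ℕ => fourier (m : ℤ) t • c m) (f t)) (n : ℕ) :
    fourierCoeff f n = c n := by
  have h := hasSum_integral_of_summable_integral_norm (μ := haarAddCircle (T := T))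
    (F := fun (m : ℕ) t => fourier (-(n : ℤ)) t • fourier (m : ℤ) t • c m)
    (fun m => integrable_of_continuous (by fun_prop))
    (by simpa [norm_smul, Circle.norm_coe] using hc)
  have hcoeff (m : ℕ) : ∫ t, fourier (-(n : ℤ)) t • fourier (m : ℤ) t • c m
      ∂(haarAddCircle (T := T)) = if (m : ℤ) = n then c m else 0 :=
    fourierCoeff_fourier_smul m n (c m)
  simp only [hcoeff, ((hf _).const_smul _).tsum_eq, Nat.cast_inj] at h
  exact h.unique (by simpa using hasSum_single n fun m hm => if_neg hm)

theorem inner_fourierCoeff [InnerProductSpace ℂ E] [CompleteSpace E] {φ : AddCircle T → E}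
    (hφ : Continuous φ) (n : ℤ) (x : E) :
    inner ℂ x (fourierCoeff φ n) = fourierCoeff (fun t => inner ℂ x (φ t)) n := by
  rw [fourierCoeff, ← integral_inner (integrable_of_continuous (by fun_prop))]
  simp only [inner_smul_right, fourierCoeff, smul_eq_mul]

end FourierCoefficients

section KernelComponent

open ComplexConjugate RKHS

variable {T : ℝ} {X H : Type*} [NormedAddCommGroup H] [InnerProductSpace ℂ H]
  [RKHS ℂ H X ℂ] [CompleteSpace H] {γ : AddCircle T → X}

theorem continuous_kerFun_of_hasSum {a : ℕ → ℂ}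
    (ha : ∀ s t, HasSum (fun N : ℕ => fourier (N : ℤ) (t - s) * a N) (kerFun H (γ t) 1 (γ s))) :
    Continuous fun t => kerFun H (γ t) (1 : ℂ) := by
  have hsum : Summable fun N => ‖a N‖ := by simpa using (ha 0 0).summable.norm
  refine continuous_of_continuous_inner ?_
  simp only [kerFun_inner, ← (ha _ _).tsum_eq, RCLike.inner_apply, map_one, mul_one]
  exact continuous_tsum (fun N => by fun_prop) hsum fun N p => by simp [Circle.norm_coe]

variable [Fact (0 < T)]

variable (H γ) in
/-- The component of frequency `N` of the kernel functions along the closed curve `γ`. -/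
noncomputable def kernelComponent (N : ℤ) : H :=
  fourierCoeff (fun t => kerFun H (γ t) (1 : ℂ)) N

theorem kernelComponent_apply (hγ : Continuous fun t => kerFun H (γ t) (1 : ℂ)) {x : X}
    {c : ℕ → ℂ} (hc : ∀ t, HasSum (fun N : ℕ => fourier (N : ℤ) t * c N) (kerFun H (γ t) 1 x))
    (N : ℕ) : kernelComponent H γ N x = c N := by
  have hsum : Summable fun N => ‖c N‖ := by simpa using (hc 0).summable.norm
  have h := inner_fourierCoeff hγ N (kerFun H x 1)
  simp only [kerFun_inner, RCLike.inner_apply, map_one, mul_one] at h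
  exact h.trans (fourierCoeff_of_hasSum hsum hc N)

theorem inner_kernelComponent (hγ : Continuous fun t => kerFun H (γ t) (1 : ℂ)) {f : H} {N : ℤ}
    {c : ℂ} (hf : ∀ t, f (γ t) = fourier (-N) t * c) :
    inner ℂ f (kernelComponent H γ N) = conj c := by
  rw [kernelComponent, inner_fourierCoeff hγ]
  simp only [inner_kerFun, RCLike.inner_apply, one_mul, hf, map_mul, fourier_neg, Complex.conj_conj]
  exact (fourierCoeff_fourier_smul N N (conj c)).trans (if_pos rfl)

end KernelComponent

section LieHilbert

open ComplexConjugate AddCircle RKHS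

theorem eval_smul_of_isHomogeneous {σ R : Type*} [CommSemiring R] {f : MvPolynomial σ R} {N : ℕ}
    (hf : f.IsHomogeneous N) (c : R) (z : σ → R) :
    MvPolynomial.eval (c • z) f = c ^ N * MvPolynomial.eval z f := by
  rw [MvPolynomial.eval_eq, MvPolynomial.eval_eq, Finset.mul_sum]
  refine Finset.sum_congr rfl fun d hd => ?_
  have hdeg : ∑ i ∈ d.support, d i = N := by
    rw [← hf (MvPolynomial.mem_support_iff.1 hd), Finsupp.weight_apply, Finsupp.sum]
    simp
  simp only [Pi.smul_apply, smul_eq_mul, mul_pow, Finset.prod_mul_distrib,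
    Finset.prod_pow_eq_pow_sum, hdeg]
  ring

variable {n : ℕ}

theorem quadForm_smul (c : ℂ) (z : EuclideanSpace ℂ (Fin n)) :
    quadForm (c • z) = c ^ 2 * quadForm z := by
  simp [quadForm, mul_pow, Finset.mul_sum]

theorem lieTerm_smul_left (ν : ℂ) (N : ℕ) (c : ℂ) (z w : EuclideanSpace ℂ (Fin n)) :
    lieTerm n ν N (c • z) w = c ^ N * lieTerm n ν N z w :=
  eval_smul_of_isHomogeneous (isHomogeneous_zonal ν _ N) c _

theorem lieTerm_smul_right (ν : ℂ) (N : ℕ) (c : ℂ) (z w : EuclideanSpace ℂ (Fin n)) :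
    lieTerm n ν N z (c • w) = conj c ^ N * lieTerm n ν N z w := by
  rw [← lieTerm_smul_left, lieTerm_eq_gegenbauer, lieTerm_eq_gegenbauer, inner_smul_left,
    inner_smul_right, quadForm_smul, quadForm_smul, map_mul, map_pow, mul_assoc, mul_left_comm]

theorem smul_mem_lieBall {c : ℂ} (hc : ‖c‖ = 1) {z : EuclideanSpace ℂ (Fin n)}
    (hz : z ∈ lieBall n) : c • z ∈ lieBall n := by
  simpa [lieBall, quadForm_smul, norm_smul, hc] using hz

/-- The closed curve `t ↦ e^(-it) w` in the Lie ball; the sign makes `K_ν(z, ·)`, which is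
antiholomorphic, have only nonnegative frequencies along it. -/
noncomputable def lieCircle (w : lieBall n) (t : UnitAddCircle) : lieBall n :=
  ⟨fourier (-1) t • w.1, smul_mem_lieBall (Circle.norm_coe _) w.2⟩

variable {ν : ℝ} [Fact (lieKernel n ν).PosSemidef]

theorem kerFun_lieHilbert_apply (z w : lieBall n) :
    kerFun (LieHilbert n ν) w 1 z = lieH z.1 w.1 ^ (-ν : ℂ) := by
  rw [kerFun_apply, OfKernel.kernel_ofKernel]
  simp [lieKernel]

theorem fourier_pow (m : ℤ) (N : ℕ) (t : UnitAddCircle) : fourier m t ^ N = fourier (N * m) t := by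
  simp [mul_smul, toCircle_nsmul]

theorem hasSum_kerFun_lieCircle (z w : lieBall n) (t : UnitAddCircle) :
    HasSum (fun N : ℕ => fourier (N : ℤ) t * lieTerm n ν N z w)
      (kerFun (LieHilbert n ν) (lieCircle w t) 1 z) := by
  rw [kerFun_lieHilbert_apply]
  convert hasSum_lieTerm ν z.2 (lieCircle w t).2 using 2 with N
  rw [lieCircle, lieTerm_smul_right, ← fourier_neg, neg_neg, fourier_pow, mul_one]

theorem continuous_kerFun_lieCircle (w : lieBall n) :
    Continuous fun t => kerFun (LieHilbert n ν) (lieCircle w t) (1 : ℂ) := by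
  refine continuous_kerFun_of_hasSum (a := fun N => lieTerm n ν N w w) fun s t => ?_
  convert hasSum_kerFun_lieCircle (lieCircle w s) w t using 2 with N
  rw [lieCircle, lieTerm_smul_left, fourier_pow, ← mul_assoc]
  congr 1
  simp [toCircle_add, sub_eq_add_neg]

variable (ν) in
/-- The function `lieTerm n ν N · w`, as an element of the Hilbert space. -/
noncomputable def lieComponent (N : ℕ) (w : lieBall n) : LieHilbert n ν :=
  kernelComponent (LieHilbert n ν) (lieCircle w) N

theorem lieComponent_apply (N : ℕ) (w z : lieBall n) :
    lieComponent ν N w z = lieTerm n ν N z w :=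
  kernelComponent_apply (continuous_kerFun_lieCircle w) (hasSum_kerFun_lieCircle z w) N

theorem inner_lieComponent {f : LieHilbert n ν} {F : MvPolynomial (Fin n) ℂ} {N : ℕ}
    (hF : F.IsHomogeneous N) (hf : ∀ z : lieBall n, f z = MvPolynomial.eval z.1.ofLp F)
    (w : lieBall n) : inner ℂ f (lieComponent ν N w) = conj (f w) := by
  refine inner_kernelComponent (continuous_kerFun_lieCircle w) fun t => ?_
  rw [hf, hf, lieCircle, WithLp.ofLp_smul, eval_smul_of_isHomogeneous hF, fourier_pow]
  congr 2
  ring_nf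

end LieHilbert

section LaplacianPower

open MvPolynomial

variable {σ K : Type*} [Field K]

theorem exists_sum_eval_eq [Finite σ] {ι : Type*} {w : ι → σ → K} {N : ℕ}
    (hw : ∀ F : MvPolynomial σ K, F.IsHomogeneous N → (∀ i, eval (w i) F = 0) → F = 0)
    (ℓ : MvPolynomial σ K →ₗ[K] K) :
    ∃ b : ι →₀ K, ∀ F, F.IsHomogeneous N → b.sum (fun i c => c * eval (w i) F) = ℓ F := by
  let V := homogeneousSubmodule σ K N
  have : Module.Finite K V := .of_fg (homogeneousSubmodule_fg σ K N)
  have hker : ⨅ i, ((aeval (w i)).toLinearMap ∘ₗ V.subtype).ker ≤ (ℓ ∘ₗ V.subtype).ker := by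
    intro F hF
    simp only [Submodule.mem_iInf, LinearMap.mem_ker] at hF
    rw [LinearMap.mem_ker, LinearMap.comp_apply, Submodule.subtype_apply, hw F F.2 hF, map_zero]
  obtain ⟨b, hb⟩ := Finsupp.mem_span_range_iff_exists_finsupp.1
    (FiniteDimensional.mem_span_of_iInf_ker_le_ker hker)
  refine ⟨b, fun F hF => ?_⟩
  have h := LinearMap.congr_fun hb ⟨F, hF⟩
  rw [Finsupp.sum, LinearMap.sum_apply] at h
  exact h

variable [Fintype σ] [CharZero K]

theorem laplacian_pow_quadPoly_pow (k : ℕ) :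
    ((laplacian (σ := σ) (K := K)) ^ k) (quadPoly σ K ^ k) =
      C (4 ^ k * k.factorial * (ascPochhammer K k).eval (Fintype.card σ / 2 : K)) := by
  induction k with
  | zero => simp
  | succ k ih =>
    have h := laplacian_quadPoly_pow_mul (isHomogeneous_one σ K)
      (by simp [laplacian_apply, Derivation.map_one_eq_zero]) k
    rw [mul_one, mul_one] at h
    rw [pow_succ, Module.End.mul_apply, h, map_smul, ih, smul_eq_C_mul, ← C_mul,
      ascPochhammer_succ_eval, Nat.factorial_succ]
    congr 1
    push_cast
    ring

theorem laplacian_pow_zonal (k : ℕ) (ν : K) (v : σ → K) :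
    (laplacian ^ k) (zonal ν v (2 * k)) = C (4 ^ k * (ascPochhammer K k).eval ν *
      (ascPochhammer K k).eval (ν + 1 - Fintype.card σ / 2) * (∑ i, v i ^ 2) ^ k) := by
  induction k generalizing ν with
  | zero => simp [zonal]
  | succ k ih =>
    rw [pow_succ, Module.End.mul_apply, laplacian_zonal, if_pos (by lia), map_smul, mul_add_one,
      Nat.add_sub_cancel, ih, smul_eq_C_mul, ← C_mul]
    simp only [ascPochhammer_succ_left, Polynomial.eval_mul, Polynomial.eval_X,
      Polynomial.eval_comp, Polynomial.eval_add, Polynomial.eval_one]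
    congr 1
    ring_nf

end LaplacianPower

section Norm

open ComplexConjugate

variable {n : ℕ}

theorem mem_lieBall_of_two_mul_norm_sq_lt {z : EuclideanSpace ℂ (Fin n)} (hz : 2 * ‖z‖ ^ 2 < 1) :
    z ∈ lieBall n :=
  ⟨by linarith [sq_nonneg ‖quadForm z‖], by nlinarith⟩

theorem eq_zero_of_eval_lieBall_eq_zero {F : MvPolynomial (Fin n) ℂ} {N : ℕ}
    (hF : F.IsHomogeneous N) (h : ∀ z : lieBall n, MvPolynomial.eval z.1.ofLp F = 0) : F = 0 := by
  refine MvPolynomial.funext fun z => ?_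
  let x : EuclideanSpace ℂ (Fin n) := WithLp.toLp 2 z
  let r : ℂ := ((2 * (1 + ‖x‖))⁻¹ : ℝ)
  have hr : ‖r‖ = (2 * (1 + ‖x‖))⁻¹ := by
    rw [Complex.norm_real, Real.norm_of_nonneg (by positivity)]
  have hr0 : r ≠ 0 := norm_ne_zero_iff.1 (hr ▸ by positivity)
  have hx : ‖r • x‖ ≤ 1 / 2 := by
    rw [norm_smul, hr, inv_mul_le_iff₀ (by positivity)]
    linarith
  have hmem : r • x ∈ lieBall n :=
    mem_lieBall_of_two_mul_norm_sq_lt (by nlinarith [norm_nonneg (r • x)])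
  have hval := h ⟨r • x, hmem⟩
  rw [WithLp.ofLp_smul, eval_smul_of_isHomogeneous hF] at hval
  rw [map_zero]
  exact (mul_eq_zero_iff_left (pow_ne_zero N hr0)).1 hval

variable {ν : ℝ} [Fact (lieKernel n ν).PosSemidef]

theorem conj_lieTerm (N : ℕ) (z w : lieBall n) :
    conj (lieTerm n ν N z w) = lieTerm n ν N w z := by
  have h (z w : lieBall n) : inner ℂ (lieComponent ν N z) (lieComponent ν N w) =
      conj (lieTerm n ν N w z) := by
    rw [inner_lieComponent (isHomogeneous_zonal (ν : ℂ) _ N) (lieComponent_apply N z),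
      lieComponent_apply]
  rw [← h, ← inner_conj_symm, h, Complex.conj_conj]

theorem exists_lieHilbert_eq_eval {F : MvPolynomial (Fin n) ℂ} {N : ℕ} (hF : F.IsHomogeneous N)
    {ℓ : MvPolynomial (Fin n) ℂ →ₗ[ℂ] ℂ}
    (hℓ : ∀ w : lieBall n, ℓ (zonal (ν : ℂ) (star w.1.ofLp) N) =
      conj (MvPolynomial.eval w.1.ofLp F)) :
    ∃ f : LieHilbert n ν, (∀ z : lieBall n, f z = MvPolynomial.eval z.1.ofLp F) ∧
      (‖f‖ ^ 2 : ℂ) = ℓ F := by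
  obtain ⟨b, hb⟩ := exists_sum_eval_eq
    (w := fun z : lieBall n => z.1.ofLp) (fun _ => eq_zero_of_eval_lieBall_eq_zero (N := N)) ℓ
  let f : LieHilbert n ν := b.sum fun w c => conj c • lieComponent ν N w
  have hf (z : lieBall n) : f z = MvPolynomial.eval z.1.ofLp F := by
    have h := hb _ (isHomogeneous_zonal (ν : ℂ) (star z.1.ofLp) N)
    rw [hℓ] at h
    rw [← Complex.conj_conj (MvPolynomial.eval _ F), ← h, Finsupp.sum, map_sum,
      ← RKHS.coeCLM_apply]
    simp only [f, Finsupp.sum, map_sum, map_smul, Finset.sum_apply, Pi.smul_apply, smul_eq_mul,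
      map_mul, RKHS.coeCLM_apply, lieComponent_apply]
    exact Finset.sum_congr rfl fun w _ => congrArg _ (conj_lieTerm N w z).symm
  refine ⟨f, hf, ?_⟩
  have hinner : inner ℂ f f = conj (ℓ F) := by
    nth_rw 2 [show f = b.sum fun w c => conj c • lieComponent ν N w from rfl]
    rw [← hb F hF, Finsupp.sum, Finsupp.sum, map_sum, inner_sum]
    refine Finset.sum_congr rfl fun w _ => ?_
    rw [inner_smul_right, inner_lieComponent hF hf, hf, map_mul]
  rw [← inner_conj_symm] at hinner
  exact (inner_self_eq_norm_sq_to_K f).symm.trans ((starRingEnd ℂ).injective hinner)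

end Norm

theorem poch_pos {a : ℝ} (ha : 0 < a) (k : ℕ) : 0 < poch a k :=
  Finset.prod_pos fun _ _ => by positivity

theorem ofReal_poch (a : ℝ) (k : ℕ) : (poch a k : ℂ) = (ascPochhammer ℂ k).eval (a : ℂ) := by
  induction k with
  | zero => simp [poch]
  | succ k ih => simp [ascPochhammer_succ_eval, ← ih, poch, Finset.prod_range_succ]

theorem exists_lieHilbert_eq_quadForm_pow {n : ℕ} {ν : ℝ} [Fact (lieKernel n ν).PosSemidef]
    {k : ℕ} (hc : poch ν k * poch (ν - ((n : ℝ) - 2) / 2) k ≠ 0) :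
    ∃ f : LieHilbert n ν, (∀ z : lieBall n, f z = quadForm z.1 ^ k) ∧
      ‖f‖ ^ 2 = (k.factorial : ℝ) * poch ((n : ℝ) / 2) k /
        (poch ν k * poch (ν - ((n : ℝ) - 2) / 2) k) := by
  set c := poch ν k * poch (ν - ((n : ℝ) - 2) / 2) k with hcdef
  have hν : (ascPochhammer ℂ k).eval (ν : ℂ) *
      (ascPochhammer ℂ k).eval ((ν : ℂ) + 1 - Fintype.card (Fin n) / 2) = c := by
    rw [hcdef, Complex.ofReal_mul, ofReal_poch, ofReal_poch]
    congr 2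
    simp only [Fintype.card_fin, Complex.ofReal_sub, Complex.ofReal_div, Complex.ofReal_natCast,
      Complex.ofReal_ofNat]
    ring
  have h4 : (4 ^ k : ℂ) ≠ 0 := pow_ne_zero k (by norm_num)
  have hC : (4 ^ k * c : ℂ) ≠ 0 := mul_ne_zero h4 (Complex.ofReal_ne_zero.2 hc)
  let ℓ : MvPolynomial (Fin n) ℂ →ₗ[ℂ] ℂ :=
    (4 ^ k * c : ℂ)⁻¹ • MvPolynomial.lcoeff ℂ 0 ∘ₗ laplacian ^ k
  have hℓ {F : MvPolynomial (Fin n) ℂ} {a : ℂ} (hF : (laplacian ^ k) F = MvPolynomial.C a) :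
      ℓ F = (4 ^ k * c : ℂ)⁻¹ * a := by
    simp [ℓ, hF]
  obtain ⟨f, hf, hnorm⟩ := exists_lieHilbert_eq_eval (ν := ν) (ℓ := ℓ)
    (isHomogeneous_quadPoly.pow k) fun w => by
      rw [hℓ (laplacian_pow_zonal k _ _), mul_assoc (4 ^ k), hν, inv_mul_cancel_left₀ hC]
      simp [eval_quadPoly]
  refine ⟨f, fun z => by rw [hf, map_pow, eval_quadPoly, quadForm], Complex.ofReal_injective ?_⟩
  rw [Complex.ofReal_pow, hnorm, hℓ (laplacian_pow_quadPoly_pow k), mul_assoc (4 ^ k), mul_inv_rev,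
    mul_assoc, inv_mul_cancel_left₀ h4, inv_mul_eq_div]
  simp [ofReal_poch]

theorem mainTheorem10 (n : ℕ) (hn : 2 < n) (ν : ℝ) (hν : ((n : ℝ) - 2) / 2 < ν) (k : ℕ) :
    ∃ _ : Fact (lieKernel n ν).PosSemidef, ∃ f : LieHilbert n ν,
      (∀ z : lieBall n, f z = quadForm (z : EuclideanSpace ℂ (Fin n)) ^ k) ∧
      ‖f‖ ^ 2 = (k.factorial : ℝ) * poch ((n : ℝ) / 2) k /
        (poch ν k * poch (ν - ((n : ℝ) - 2) / 2) k) := by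
  have hn' : (2 : ℝ) < n := by exact_mod_cast hn
  have hμ : 0 < ((n : ℝ) - 2) / 2 := by linarith
  have : Fact (lieKernel n ν).PosSemidef := ⟨posSemidef_lieKernel (by ring) hμ hν⟩
  have hc : 0 < poch ν k * poch (ν - ((n : ℝ) - 2) / 2) k :=
    mul_pos (poch_pos (hμ.trans hν) k) (poch_pos (sub_pos.2 hν) k)
  exact ⟨this, exists_lieHilbert_eq_quadForm_pow hc.ne'⟩
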